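/- A p-algebra is a bounded distributive lattice with a unary operation $*$ such that $x\wedge y=0$ if and only if $x\le y^*$. For $m\ge 0$ let $\bar{\mathbf B}_m$ be the p-algebra obtained from the Boolean algebra with $m$ atoms by adding a new top element above the old one, and let $\mathsf{Pa}_m=\mathbf{HSP}(\bar{\mathbf B}_m)$ be the variety it generates. For a finite poset $P$ let $\varepsilon(P)$ be the p-algebra of upsets of $P$, ordered by inclusion, with $V^*=\{x\in P : \text{no } y\ge x \text{ lies in } V\}$. For a p-algebra $\mathbf A$ let $\mathbf Q(\mathbf A)$ be the quasivariety generated by $\mathbf A$, that is, the class of all p-algebras satisfying every quasi-identity valid in $\mathbf A$. For a non-empty set $M$ and a possibly empty family $\mathcal F$ of non-empty subsets of $M$ let $$P(M,\mathcal F)=\{M\}\cup\{\{x\}: x\in M\}\cup\mathcal F,$$ ordered by reverse inclusion. Theorem. Let $m\ge 2$, let $M$ be a set with $|M|=m+1$, let $\mathcal F$ be a family of non-empty subsets of $M$, and let $P=P(M,\mathcal F)$. Then $\mathsf{Pa}_m\subseteq\mathbf Q(\varepsilon(P))$ if and only if there are distinct $a,b\in M$ such that $$\mathcal F\setminus\bigl(\{M\}\cup\{\{x\}:x\in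 M\}\bigr)\subseteq\bigl\{\{a,b\},\ M\setminus\{a\},\ M\setminus\{b\}\bigr\}.$$ In particular, if $\mathcal F$ contains neither $M$ nor a singleton, then $\mathsf{Pa}_m\subseteq\mathbf Q(\varepsilon(P))$ if and only if $\mathcal F\subseteq\{\{a,b\},M\setminus\{a\},M\setminus\{b\}\}$ for some distinct $a,b\in M$. -/

import Mathlib

universe u v w

/-- A p-algebra: a bounded distributive lattice with a unary operation `pc` (written `*` in the
literature) such that `x ⊓ y = ⊥` if and only if `x ≤ pc y`. -/
class PAlgebra (α : Type u) extends DistribLattice α, BoundedOrder α where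
  pc : α → α
  inf_eq_bot_iff : ∀ x y : α, x ⊓ y = ⊥ ↔ x ≤ pc y

/-- Bundled p-algebras with carrier in `Type u`. A class of p-algebras is a `Set PAlg`. -/
structure PAlg : Type (u + 1) where
  carrier : Type u
  [str : PAlgebra carrier]

attribute [instance] PAlg.str

/-- Homomorphisms of p-algebras, in the signature `⊓, ⊔, pc, ⊥, ⊤`. -/
structure PHom (α : Type u) (β : Type v) [PAlgebra α] [PAlgebra β] where
  toFun : α → β
  map_inf : ∀ x y, toFun (x ⊓ y) = toFun x ⊓ toFun y
  map_sup : ∀ x y, toFun (x ⊔ y) = toFun x ⊔ toFun y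
  map_pc : ∀ x, toFun (PAlgebra.pc x) = PAlgebra.pc (toFun x)
  map_bot : toFun ⊥ = ⊥
  map_top : toFun ⊤ = ⊤

/-- The direct power of a p-algebra, with coordinatewise operations. -/
instance PAlgebra.power (ι : Type v) (α : Type u) [PAlgebra α] : PAlgebra (ι → α) where
  pc f := fun i => PAlgebra.pc (f i)
  inf_eq_bot_iff f g := by
    rw [funext_iff, Pi.le_def]
    exact forall_congr' fun i => PAlgebra.inf_eq_bot_iff (f i) (g i)

/-- The variety `HSP(A)` generated by `A`: all homomorphic images of algebras `C` that are
isomorphic to a subalgebra of a direct power of `A`. -/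
def HSP (A : PAlg.{0}) : Set PAlg.{w} :=
  {B | ∃ (ι : Type w) (C : PAlg.{w}) (e : PHom C.carrier (ι → A.carrier))
      (h : PHom C.carrier B.carrier),
      Function.Injective e.toFun ∧ Function.Surjective h.toFun}

/-- Terms in the language of p-algebras over countably many variables. -/
inductive PTerm : Type
  | var : ℕ → PTerm
  | inf : PTerm → PTerm → PTerm
  | sup : PTerm → PTerm → PTerm
  | pc : PTerm → PTerm
  | bot : PTerm
  | top : PTerm

/-- The value of a term under an assignment of its variables. -/
def PTerm.eval {α : Type u} [PAlgebra α] (ρ : ℕ → α) : PTerm → α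
  | .var n => ρ n
  | .inf s t => s.eval ρ ⊓ t.eval ρ
  | .sup s t => s.eval ρ ⊔ t.eval ρ
  | .pc t => PAlgebra.pc (t.eval ρ)
  | .bot => ⊥
  | .top => ⊤

/-- A quasi-identity `s₁ ≈ t₁ ∧ … ∧ sₙ ≈ tₙ → s ≈ t` (with `n = 0` allowed). -/
structure QuasiIdentity : Type where
  premises : List (PTerm × PTerm)
  conclusion : PTerm × PTerm

/-- The quasi-identity `q` is valid in `A`. -/
def PAlg.Models (A : PAlg.{u}) (q : QuasiIdentity) : Prop :=
  ∀ ρ : ℕ → A.carrier,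
    (∀ e ∈ q.premises, e.1.eval ρ = e.2.eval ρ) →
      q.conclusion.1.eval ρ = q.conclusion.2.eval ρ

/-- A quasivariety of p-algebras: a class axiomatized by quasi-identities. -/
def IsQuasivariety (K : Set PAlg.{u}) : Prop :=
  ∃ Q : Set QuasiIdentity, K = {B | ∀ q ∈ Q, B.Models q}

/-- The quasivariety `Q(A)` generated by `A`: all p-algebras that satisfy every quasi-identity
valid in `A`. -/
def quasivarietyGen (A : PAlg.{u}) : Set PAlg.{w} :=
  {B | ∀ q : QuasiIdentity, A.Models q → B.Models q}

/-- `Q(A)` is the smallest quasivariety that contains `A`. -/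
theorem quasivarietyGen_isLeast (A : PAlg.{u}) :
    IsLeast {K : Set PAlg.{u} | IsQuasivariety K ∧ A ∈ K} (quasivarietyGen A) := by
  refine ⟨⟨⟨{q | A.Models q}, rfl⟩, fun q hq => hq⟩, ?_⟩
  rintro K ⟨⟨Q, rfl⟩, hA⟩ B hB q hq
  exact hB q (hA q hq)

open Classical in
/-- The algebra `B̄ₘ`: the Boolean algebra of all subsets of an `m`-element set together with an
extra element on top, covering the old top element. -/
noncomputable instance barB.instPAlgebra (m : ℕ) : PAlgebra (WithTop (Set (Fin m))) where
  pc x :=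
    match x with
    | ⊤ => ((∅ : Set (Fin m)) : WithTop (Set (Fin m)))
    | (s : Set (Fin m)) => if s = ∅ then ⊤ else ((sᶜ : Set (Fin m)) : WithTop (Set (Fin m)))
  inf_eq_bot_iff x y := by
    have hb : (⊥ : WithTop (Set (Fin m))) = ((∅ : Set (Fin m)) : WithTop (Set (Fin m))) := rfl
    rw [hb]
    induction y using WithTop.recTopCoe with
    | top =>
      rw [inf_top_eq]
      constructor
      · exact fun h => h.le
      · exact fun h => le_antisymm h (by rw [← hb]; exact bot_le)
    | coe s =>
      by_cases hs : s = ∅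
      · subst hs
        have : x ⊓ ((∅ : Set (Fin m)) : WithTop (Set (Fin m))) = (∅ : Set (Fin m)) := by
          rw [← hb]; exact inf_bot_eq x
        simp [this]
      · simp only [hs, if_false]
        induction x using WithTop.recTopCoe with
        | top =>
          rw [top_inf_eq]
          simp [hs]
        | coe t =>
          rw [← WithTop.coe_inf, WithTop.coe_le_coe, WithTop.coe_inj]
          exact Set.subset_compl_iff_disjoint_right.trans Set.disjoint_iff_inter_eq_empty |>.symm

/-- `B̄ₘ` as a bundled p-algebra. -/
noncomputable def barB (m : ℕ) : PAlg.{0} := ⟨WithTop (Set (Fin m))⟩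

/-- The variety `Paₘ = HSP(B̄ₘ)`. -/
def Pa (m : ℕ) : Set PAlg.{w} := HSP (barB m)

/-- The carrier of the dual p-algebra `ε(P)` of a poset `P`: the upsets of `P`. -/
structure Upset (P : Type u) [PartialOrder P] where
  carrier : Set P
  upper : IsUpperSet carrier

/-- Upsets are ordered by inclusion; `⊓, ⊔, ⊥, ⊤` are `∩, ∪, ∅, P`, and the pseudocomplement of
`V` is the set of all points with no point of `V` above them. -/
instance Upset.instPAlgebra (P : Type u) [PartialOrder P] : PAlgebra (Upset P) where
  le U V := U.carrier ⊆ V.carrier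
  le_refl _ := Set.Subset.rfl
  le_trans _ _ _ h k := Set.Subset.trans h k
  le_antisymm := by
    rintro ⟨U, hU⟩ ⟨V, hV⟩ h k
    obtain rfl : U = V := Set.Subset.antisymm h k
    rfl
  inf U V := ⟨U.carrier ∩ V.carrier, U.upper.inter V.upper⟩
  sup U V := ⟨U.carrier ∪ V.carrier, U.upper.union V.upper⟩
  inf_le_left _ _ := Set.inter_subset_left
  inf_le_right _ _ := Set.inter_subset_right
  le_inf _ _ _ h k := Set.subset_inter h k
  le_sup_left _ _ := Set.subset_union_left
  le_sup_right _ _ := Set.subset_union_right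
  sup_le _ _ _ h k := Set.union_subset h k
  le_sup_inf _ _ _ := (Set.union_inter_distrib_left _ _ _).symm.subset
  bot := ⟨∅, isUpperSet_empty⟩
  top := ⟨Set.univ, isUpperSet_univ⟩
  bot_le _ := Set.empty_subset _
  le_top _ := Set.subset_univ _
  pc V := ⟨{x | ∀ y, x ≤ y → y ∉ V.carrier}, fun _ _ hab ha y hy => ha y (hab.trans hy)⟩
  inf_eq_bot_iff U V := by
    constructor
    · intro h x hx y hxy hy
      have h' : U.carrier ∩ V.carrier = ∅ := congrArg Upset.carrier h
      exact (Set.eq_empty_iff_forall_notMem.mp h') y ⟨U.upper hxy hx, hy⟩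
    · intro h
      have h' : U.carrier ∩ V.carrier = ∅ :=
        Set.eq_empty_iff_forall_notMem.mpr fun x hx => h hx.1 x le_rfl hx.2
      change (⟨U.carrier ∩ V.carrier, _⟩ : Upset P) = ⟨∅, _⟩
      simp only [h']

/-- The dual p-algebra `ε(P)` of the poset `P`. -/
def dualAlg (P : Type u) [PartialOrder P] : PAlg.{u} := ⟨Upset P⟩

/-- The trivial members of `P(M, F)`, present for every `F`: the whole base `M` and the
singletons `{a}` with `a ∈ M`. -/
def baseSets (M : Type u) : Set (Set M) := {X | X = Set.univ ∨ ∃ a : M, X = {a}}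

/-- The underlying set of the reduced poset `P(M, F)` with base `M`:
`{M} ∪ {{a} : a ∈ M} ∪ F`. -/
def ReducedPoset (M : Type u) (F : Set (Set M)) : Type u := {X : Set M // X ∈ baseSets M ∪ F}

/-- The order of `P(M, F)` is reverse inclusion. -/
instance ReducedPoset.instPartialOrder (M : Type u) (F : Set (Set M)) :
    PartialOrder (ReducedPoset M F) where
  le A B := B.1 ⊆ A.1
  le_refl _ := Set.Subset.rfl
  le_trans _ _ _ h k := Set.Subset.trans k h
  le_antisymm _ _ h k := Subtype.ext (Set.Subset.antisymm k h)

/-! Homomorphisms from a p-algebra `A` to `ε(P)` correspond to antitone maps from `P` to the prime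
ideals of `A` such that, whenever `x*` lies in the image of `X`, some point above `X` has an image
that omits `x`. In a member of `Paₘ` an identity in the style of Lee bounds the number of minimal
prime ideals below any prime ideal `I` by `m`. Hence, if `g : M → Fin m` is a surjective colouring
such that each `X ∈ F` is monochromatic or meets every colour, then `I` and its minimal prime ideals
can be spread over `P(M, F)` along `g`, and the resulting homomorphisms separate points. Conversely,
a homomorphism from `B̄ₘ` to `ε(P(M, F))` that separates the two largest elements colours the
singletons by the atoms of `B̄ₘ`, and this is such a colouring.

When `|M| = m + 1`, a surjective colouring identifies exactly one pair `{a, b}` of points. So a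
monochromatic set with two or more points is `{a, b}`, and a proper subset meeting every colour
misses exactly one point, which is `a` or `b`.
-/

open Function PAlgebra

namespace PAlgebra

variable {α : Type u} [PAlgebra α] {x y z : α}

theorem inf_pc_self (x : α) : x ⊓ pc x = ⊥ :=
  inf_comm x (pc x) ▸ (inf_eq_bot_iff _ _).2 le_rfl

theorem pc_bot : pc (⊥ : α) = ⊤ :=
  top_le_iff.1 ((inf_eq_bot_iff _ _).1 (inf_bot_eq _))

theorem pc_top : pc (⊤ : α) = ⊥ := by
  rw [← inf_pc_self (⊤ : α), top_inf_eq]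

theorem pc_anti (h : x ≤ y) : pc y ≤ pc x :=
  (inf_eq_bot_iff _ _).1 (le_bot_iff.1 ((inf_le_inf_left _ h).trans
    (inf_comm y (pc y) ▸ inf_pc_self y).le))

theorem le_pc_pc (x : α) : x ≤ pc (pc x) :=
  (inf_eq_bot_iff _ _).1 (inf_pc_self x)

theorem pc_sup_pc_self (x : α) : pc (x ⊔ pc x) = ⊥ :=
  le_bot_iff.1 <| (le_inf (pc_anti le_sup_left) (pc_anti le_sup_right)).trans
    (inf_pc_self (pc x)).le

theorem le_pc_pc_inf (hx : z ≤ pc (pc x)) (hy : z ≤ pc (pc y)) : z ≤ pc (pc (x ⊓ y)) := by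
  have hzy : z ⊓ pc (x ⊓ y) ⊓ x = ⊥ := by
    have h : pc (x ⊓ y) ⊓ x ≤ pc y := by
      rw [← inf_eq_bot_iff, inf_assoc, inf_comm, inf_pc_self]
    rw [inf_assoc, ← le_bot_iff, ← inf_pc_self (pc y), inf_comm (pc y)]
    exact inf_le_inf hy h
  rw [← inf_eq_bot_iff, ← le_bot_iff, ← inf_pc_self (pc x)]
  exact le_inf ((inf_eq_bot_iff _ _).1 hzy) (inf_le_left.trans hx)

instance ulift (α : Type u) [PAlgebra α] : PAlgebra (ULift.{v} α) where
  pc x := ⟨pc x.down⟩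
  inf_eq_bot_iff x y := by
    rw [← ULift.down_injective.eq_iff]
    exact inf_eq_bot_iff x.down y.down

end PAlgebra

namespace PHom

variable {α : Type u} {β : Type v} [PAlgebra α] [PAlgebra β]

theorem map_eval (h : PHom α β) (ρ : ℕ → α) (t : PTerm) :
    h.toFun (t.eval ρ) = t.eval (fun n => h.toFun (ρ n)) := by
  induction t with
  | var n => rfl
  | inf s t hs ht => simp only [PTerm.eval, h.map_inf, hs, ht]
  | sup s t hs ht => simp only [PTerm.eval, h.map_sup, hs, ht]
  | pc t ht => simp only [PTerm.eval, h.map_pc, ht]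
  | bot => exact h.map_bot
  | top => exact h.map_top

/-- The bounded lattice homomorphism underlying a homomorphism of p-algebras. -/
def toBoundedLatticeHom (h : PHom α β) : BoundedLatticeHom α β where
  toFun := h.toFun
  map_sup' := h.map_sup
  map_inf' := h.map_inf
  map_top' := h.map_top
  map_bot' := h.map_bot

/-- The coordinate projection of a direct power. -/
def proj {ι : Type v} (i : ι) : PHom (ι → α) α where
  toFun f := f i
  map_inf _ _ := rfl
  map_sup _ _ := rfl
  map_pc _ := rfl
  map_bot := rfl
  map_top := rfl

/-- Precomposition of a homomorphism with the isomorphism of `α` and its lift to a higher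
universe. -/
def ofULift (h : PHom (ULift.{w} α) β) : PHom α β where
  toFun x := h.toFun ⟨x⟩
  map_inf x y := h.map_inf ⟨x⟩ ⟨y⟩
  map_sup x y := h.map_sup ⟨x⟩ ⟨y⟩
  map_pc x := h.map_pc ⟨x⟩
  map_bot := h.map_bot
  map_top := h.map_top

end PHom

theorem ulift_mem_HSP (A : PAlg.{0}) :
    (⟨ULift.{w} A.carrier⟩ : PAlg.{w}) ∈ (HSP A : Set PAlg.{w}) :=
  ⟨PUnit, ⟨ULift.{w} A.carrier⟩,
    ⟨fun x _ => x.down, fun _ _ => rfl, fun _ _ => rfl, fun _ => rfl, rfl, rfl⟩,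
    ⟨id, fun _ _ => rfl, fun _ _ => rfl, fun _ => rfl, rfl, rfl⟩,
    fun _ _ h => ULift.down_injective (congrFun h PUnit.unit), surjective_id⟩

section Separation

theorem mem_quasivarietyGen_of_separating {A : PAlg.{u}} {B : PAlg.{w}}
    (hs : ∀ x y : B.carrier, (∀ h : PHom B.carrier A.carrier, h.toFun x = h.toFun y) → x = y) :
    B ∈ (quasivarietyGen A : Set PAlg.{w}) := by
  intro q hq ρ hρ
  refine hs _ _ fun h => ?_
  rw [h.map_eval, h.map_eval]
  refine hq _ fun e he => ?_
  rw [← h.map_eval, ← h.map_eval, hρ e he]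

variable {α : Type u} {β : Type w} [PAlgebra α] [PAlgebra β]

/-- The diagram of a finite p-algebra: the list of equations recording its operation tables, where
the element `a` is named by the variable `v a`. -/
noncomputable def diagram [Fintype α] (v : α → ℕ) : List (PTerm × PTerm) :=
  let elems := (Finset.univ : Finset α).toList
  let pairs := (Finset.univ : Finset (α × α)).toList
  [(.bot, .var (v ⊥)), (.top, .var (v ⊤))] ++
    elems.map (fun a => (.pc (.var (v a)), .var (v (pc a)))) ++
    pairs.map (fun p => (.inf (.var (v p.1)) (.var (v p.2)), .var (v (p.1 ⊓ p.2)))) ++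
    pairs.map (fun p => (.sup (.var (v p.1)) (.var (v p.2)), .var (v (p.1 ⊔ p.2))))

theorem forall_mem_diagram_iff [Fintype α] {v : α → ℕ} {ρ : ℕ → β} :
    (∀ e ∈ diagram v, e.1.eval ρ = e.2.eval ρ) ↔
      ∃ h : PHom α β, ∀ a, h.toFun a = ρ (v a) := by
  trans (⊥ = ρ (v ⊥) ∧ ⊤ = ρ (v ⊤)) ∧ (∀ a, pc (ρ (v a)) = ρ (v (pc a))) ∧
      (∀ a b, ρ (v a) ⊓ ρ (v b) = ρ (v (a ⊓ b))) ∧ ∀ a b, ρ (v a) ⊔ ρ (v b) = ρ (v (a ⊔ b))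
  · simp only [diagram, List.forall_mem_append, List.forall_mem_map, List.forall_mem_cons,
      PTerm.eval, Finset.mem_toList, Finset.mem_univ, Prod.forall,
      List.not_mem_nil, forall_const, implies_true, and_true, and_assoc, false_imp_iff]
  · constructor
    · rintro ⟨⟨hbot, htop⟩, hpc, hinf, hsup⟩
      exact ⟨⟨fun a => ρ (v a), fun a b => (hinf a b).symm, fun a b => (hsup a b).symm,
        fun a => (hpc a).symm, hbot.symm, htop.symm⟩, fun _ => rfl⟩
    · rintro ⟨h, hh⟩
      simp only [← hh, h.map_bot, h.map_top, h.map_pc, h.map_inf, h.map_sup, implies_true,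
        and_self]

/-- If no homomorphism separates `x` from `y`, then the quasi-identity `diagram → x ≈ y` is valid
in `A`; it fails in `B` under the naming assignment. -/
theorem separating_of_mem_quasivarietyGen {A : PAlg.{u}} {B : PAlg.{w}} [Finite B.carrier]
    (hB : B ∈ (quasivarietyGen A : Set PAlg.{w})) {x y : B.carrier} (hxy : x ≠ y) :
    ∃ h : PHom B.carrier A.carrier, h.toFun x ≠ h.toFun y := by
  by_contra! hcon
  cases nonempty_fintype B.carrier
  obtain ⟨v, hv⟩ := exists_injective_nat B.carrier
  let q : QuasiIdentity := ⟨diagram v, (.var (v x), .var (v y))⟩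
  have hA : A.Models q := by
    intro ρ hρ
    obtain ⟨h, hh⟩ := forall_mem_diagram_iff.1 hρ
    simpa only [q, PTerm.eval, hh] using hcon h
  have hname : ∀ b, invFun v (v b) = b := leftInverse_invFun hv
  have heq := hB q hA (invFun v) <| forall_mem_diagram_iff.2
    ⟨⟨id, fun _ _ => rfl, fun _ _ => rfl, fun _ => rfl, rfl, rfl⟩, fun b => (hname b).symm⟩
  exact hxy (by simpa only [q, PTerm.eval, hname] using heq)

end Separation

section LeeTerm

variable {α : Type u} {β : Type v} [PAlgebra α] [PAlgebra β] {ι : Type*} [Fintype ι]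
  [DecidableEq ι]

/-- The meet of `t i` with the pseudocomplements of all other members of the family `t`; these
elements are pairwise disjoint. -/
def disjointPart (t : ι → α) (i : ι) : α :=
  t i ⊓ (Finset.univ.erase i).inf fun j => pc (t j)

/-- The term `⋁ᵢ (tᵢ ∧ ⋀_{j ≠ i} tⱼ*)*`, a symmetric variant of the terms in Lee's identities.
It is identically `⊤` for `n + 1` arguments when there are at most `n` minimal prime ideals below
each prime ideal. -/
def leeTerm (t : ι → α) : α :=
  Finset.univ.sup fun i => pc (disjointPart t i)

theorem disjointPart_inf_disjointPart (t : ι → α) {i j : ι} (hij : i ≠ j) :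
    disjointPart t i ⊓ disjointPart t j = ⊥ := by
  have hi : disjointPart t j ≤ pc (t i) :=
    inf_le_right.trans (Finset.inf_le (Finset.mem_erase.2 ⟨hij, Finset.mem_univ i⟩))
  exact le_bot_iff.1 ((inf_le_inf inf_le_left hi).trans (inf_pc_self (t i)).le)

theorem PHom.map_disjointPart (h : PHom α β) (t : ι → α) (i : ι) :
    h.toFun (disjointPart t i) = disjointPart (fun j => h.toFun (t j)) i := by
  have hinf := (map_finset_inf h.toBoundedLatticeHom (Finset.univ.erase i) fun j => pc (t j)).trans
    (Finset.inf_congr rfl fun j _ => h.map_pc (t j))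
  exact (h.map_inf _ _).trans (congrArg _ hinf)

theorem PHom.map_leeTerm (h : PHom α β) (t : ι → α) :
    h.toFun (leeTerm t) = leeTerm fun i => h.toFun (t i) :=
  (map_finset_sup h.toBoundedLatticeHom _ _).trans <| Finset.sup_congr rfl fun i _ =>
    (h.map_pc _).trans (congrArg pc (h.map_disjointPart t i))

theorem leeTerm_eq_top_of_mem_HSP {A : PAlg.{0}} (hA : ∀ t : ι → A.carrier, leeTerm t = ⊤)
    {B : PAlg.{w}} (hB : B ∈ (HSP A : Set PAlg.{w})) (t : ι → B.carrier) : leeTerm t = ⊤ := by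
  obtain ⟨κ, C, e, h, he, hh⟩ := hB
  have hpower : ∀ s : ι → κ → A.carrier, leeTerm s = ⊤ := fun s =>
    funext fun k => ((PHom.proj k).map_leeTerm s).trans (hA _)
  have hC : ∀ s : ι → C.carrier, leeTerm s = ⊤ := fun s =>
    he (by rw [e.map_leeTerm, hpower, e.map_top])
  choose s hs using fun i => hh (t i)
  rw [← h.map_top, ← hC s, h.map_leeTerm]
  simp only [hs]

theorem exists_coe_singleton_le {m : ℕ} [NeZero m] {x : WithTop (Set (Fin m))} (hx : x ≠ ⊥) :
    ∃ p : Fin m, (({p} : Set (Fin m)) : WithTop (Set (Fin m))) ≤ x := by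
  induction x using WithTop.recTopCoe with
  | top => exact ⟨0, le_top⟩
  | coe s =>
    obtain ⟨p, hp⟩ : s.Nonempty :=
      Set.nonempty_iff_ne_empty.2 fun hs => hx (congrArg _ hs)
    exact ⟨p, WithTop.coe_le_coe.2 (Set.singleton_subset_iff.2 hp)⟩

theorem leeTerm_barB {m : ℕ} [NeZero m] (hι : m < Fintype.card ι)
    (t : ι → WithTop (Set (Fin m))) : leeTerm t = ⊤ := by
  obtain ⟨i, hi⟩ : ∃ i, disjointPart t i = ⊥ := by
    by_contra! hne
    choose p hp using fun i => exists_coe_singleton_le (hne i)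
    obtain ⟨i, j, hij, hpij⟩ := Fintype.exists_ne_map_eq_of_card_lt p (by simpa using hι)
    have hle : (({p i} : Set (Fin m)) : WithTop (Set (Fin m))) ≤ (∅ : Set (Fin m)) :=
      (le_inf (hp i) (hpij ▸ hp j)).trans (disjointPart_inf_disjointPart t hij).le
    exact WithTop.coe_le_coe.1 hle (Set.mem_singleton _)
  refine top_le_iff.1 (le_trans ?_ (Finset.le_sup (Finset.mem_univ i)))
  rw [hi, pc_bot]

end LeeTerm

section PrimeIdeals

theorem exists_isPrime_of_not_le {α : Type u} [DistribLattice α] {x y : α} (h : ¬ x ≤ y) :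
    ∃ I : Order.Ideal α, I.IsPrime ∧ x ∉ I ∧ y ∈ I := by
  have hd : Disjoint (Order.PFilter.principal x : Set α) (Order.Ideal.principal y : Set α) :=
    Set.disjoint_left.2 fun z hz hz' => h (le_trans hz hz')
  obtain ⟨I, hI, hyI, hdis⟩ := DistribLattice.prime_ideal_of_disjoint_filter_ideal hd
  exact ⟨I, hI, Set.disjoint_left.1 hdis (Order.PFilter.mem_principal.2 le_rfl),
    hyI (Order.Ideal.mem_principal.2 le_rfl)⟩

theorem isPrime_finset_inf_mem_iff {α : Type u} [Lattice α] [OrderTop α] {I : Order.Ideal α}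
    (hI : I.IsPrime) {ι : Type*} {s : Finset ι} {f : ι → α} :
    s.inf f ∈ I ↔ ∃ i ∈ s, f i ∈ I := by
  refine ⟨fun h => ?_, fun ⟨i, hi, hf⟩ => I.lower (Finset.inf_le hi) hf⟩
  contrapose! h
  exact Finset.inf_induction (p := (· ∉ I)) hI.toIsProper.top_notMem
    (fun x hx y hy hxy => (hI.mem_or_mem hxy).elim hx hy) h

variable {α : Type u} [PAlgebra α] {I J : Order.Ideal α}

theorem mem_or_pc_mem (hI : I.IsPrime) (x : α) : x ∈ I ∨ pc x ∈ I :=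
  hI.mem_or_mem (by rw [inf_pc_self]; exact I.bot_mem)

theorem minimal_isPrime_of_pc_notMem (hJ : J.IsPrime) (hpc : ∀ x ∈ J, pc x ∉ J) :
    Minimal Order.Ideal.IsPrime J :=
  ⟨hJ, fun _ hK hKJ x hx => (mem_or_pc_mem hK x).resolve_right fun h => hpc x hx (hKJ h)⟩

/-- The filter of elements `z` with `a ∧ b ≤ z**` for some `a ∉ I` contains `b`, the complement of
`I` and all dense elements, and it is proper because `b* ∈ I`. A prime ideal that avoids it does
what is required. -/
theorem exists_minimal_isPrime_le (hI : I.IsPrime) {b : α} (hb : pc b ∈ I) :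
    ∃ J : Order.Ideal α, Minimal Order.Ideal.IsPrime J ∧ J ≤ I ∧ b ∉ J := by
  let S : Set α := {z | ∃ a ∉ I, a ⊓ b ≤ pc (pc z)}
  have htop : ⊤ ∉ I := hI.toIsProper.top_notMem
  have hS : Order.IsPFilter S := by
    refine Order.IsPFilter.of_def ⟨b, ⊤, htop, inf_le_right.trans (le_pc_pc b)⟩ ?_ ?_
    · rintro x ⟨a, ha, hx⟩ y ⟨a', ha', hy⟩
      refine ⟨x ⊓ y, ⟨a ⊓ a', fun h => (hI.mem_or_mem h).elim ha ha', ?_⟩,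
        inf_le_left, inf_le_right⟩
      exact le_pc_pc_inf ((inf_le_inf_right b inf_le_left).trans hx)
        ((inf_le_inf_right b inf_le_right).trans hy)
    · exact fun hxy ⟨a, ha, hx⟩ => ⟨a, ha, hx.trans (pc_anti (pc_anti hxy))⟩
  have hproper : ⊥ ∉ S := by
    rintro ⟨a, ha, h⟩
    rw [pc_bot, pc_top, le_bot_iff, inf_eq_bot_iff] at h
    exact ha (I.lower h hb)
  obtain ⟨J, hJ, -, hdis⟩ := DistribLattice.prime_ideal_of_disjoint_filter_ideal
    (F := hS.toPFilter) (I := ⊥) <| Set.disjoint_left.2 fun z hz hz' =>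
      hproper ((le_bot_iff.1 hz' : z = ⊥) ▸ hz)
  have hSJ : ∀ z ∈ S, z ∉ J := fun z hz => Set.disjoint_left.1 hdis hz
  refine ⟨J, minimal_isPrime_of_pc_notMem hJ fun x hx hpx => ?_, fun x hx => ?_, hSJ b ?_⟩
  · refine hSJ (x ⊔ pc x) ⟨⊤, htop, ?_⟩ (Order.Ideal.sup_mem hx hpx)
    rw [pc_sup_pc_self, pc_bot]
    exact le_top
  · exact by_contra fun hxI => hSJ x ⟨x, hxI, inf_le_left.trans (le_pc_pc x)⟩ hx
  · exact ⟨⊤, htop, inf_le_right.trans (le_pc_pc b)⟩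

theorem pc_mem_iff_of_minimal (hJ : Minimal Order.Ideal.IsPrime J) {x : α} :
    pc x ∈ J ↔ x ∉ J := by
  refine ⟨fun h => ?_, (mem_or_pc_mem hJ.prop x).resolve_left⟩
  obtain ⟨K, hK, hKJ, hx⟩ := exists_minimal_isPrime_le hJ.prop h
  rwa [hJ.eq_of_le hK.prop hKJ] at hx

/-- The minimal prime ideals contained in `I`. For `I` prime they are the maximal points above `I`
of the dual space, whose order reverses inclusion. -/
def minimalPrimesBelow (I : Order.Ideal α) : Set (Order.Ideal α) :=
  {J | Minimal Order.Ideal.IsPrime J ∧ J ≤ I}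

theorem minimalPrimesBelow_nonempty (hI : I.IsPrime) : (minimalPrimesBelow I).Nonempty := by
  obtain ⟨J, hJ, hJI, -⟩ := exists_minimal_isPrime_le hI (b := ⊤) (pc_top (α := α) ▸ I.bot_mem)
  exact ⟨J, hJ, hJI⟩

variable {ι : Type*}

theorem exists_mem_iff_ne [Finite ι] {u : ι → Order.Ideal α}
    (hu : ∀ i, Minimal Order.Ideal.IsPrime (u i)) (hinj : Injective u) :
    ∃ t : ι → α, ∀ i j, t i ∈ u j ↔ i ≠ j := by
  classical
  cases nonempty_fintype ι
  have hsep : ∀ i j, i ≠ j → ∃ b, b ∉ u i ∧ b ∈ u j := by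
    intro i j hij
    have hnle : ¬ u j ≤ u i := fun h => hij (hinj ((hu i).eq_of_le (hu j).prop h).symm)
    obtain ⟨b, hbj, hbi⟩ := SetLike.not_le_iff_exists.1 hnle
    exact ⟨b, hbi, hbj⟩
  choose! b hbi hbj using hsep
  refine ⟨fun i => (Finset.univ.erase i).inf (b i), fun i j => ?_⟩
  rw [isPrime_finset_inf_mem_iff (hu j).prop]
  constructor
  · rintro ⟨k, hk, hbk⟩ rfl
    exact hbi i k (Finset.ne_of_mem_erase hk).symm hbk
  · exact fun hij => ⟨j, Finset.mem_erase.2 ⟨hij.symm, Finset.mem_univ j⟩, hbj i j hij⟩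

theorem not_injective_of_leeTerm_eq_top [Fintype ι] [DecidableEq ι]
    (hα : ∀ t : ι → α, leeTerm t = ⊤) (hI : I.IsPrime) {u : ι → Order.Ideal α}
    (hu : ∀ i, u i ∈ minimalPrimesBelow I) : ¬ Injective u := by
  intro hinj
  obtain ⟨t, ht⟩ := exists_mem_iff_ne (fun i => (hu i).1) hinj
  have hpart : ∀ i, disjointPart t i ∉ u i := by
    intro i hi
    rcases (hu i).1.prop.mem_or_mem hi with h | h
    · exact (ht i i).1 h rfl
    · obtain ⟨j, hj, hpc⟩ := (isPrime_finset_inf_mem_iff (hu i).1.prop).1 h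
      exact (pc_mem_iff_of_minimal (hu i).1).1 hpc ((ht j i).2 (Finset.ne_of_mem_erase hj))
  refine hI.toIsProper.top_notMem (hα t ▸ (Order.Ideal.finsetSup_mem_iff I).2 fun i _ => ?_)
  exact (hu i).2 ((pc_mem_iff_of_minimal (hu i).1).2 (hpart i))

end PrimeIdeals

theorem exists_surjective_of_forall_not_injective {S : Type u} [Nonempty S] {n : ℕ}
    (h : ∀ f : Fin (n + 1) → S, ¬ Injective f) : ∃ r : Fin n → S, Surjective r := by
  obtain ⟨⟨e⟩⟩ | ⟨⟨e⟩⟩ := Embedding.total S (Fin n)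
  · exact ⟨invFun e, invFun_surjective e.injective⟩
  · exact ⟨e, fun s => by_contra fun hs => h (Fin.cons s e)
      (Fin.cons_injective_iff.2 ⟨hs, e.injective⟩)⟩

theorem exists_range_eq_minimalPrimesBelow {α : Type u} [PAlgebra α] {I : Order.Ideal α} {m : ℕ}
    (hα : ∀ t : Fin (m + 1) → α, leeTerm t = ⊤) (hI : I.IsPrime) :
    ∃ r : Fin m → Order.Ideal α, Set.range r = minimalPrimesBelow I := by
  have : Nonempty (minimalPrimesBelow I) := (minimalPrimesBelow_nonempty hI).to_subtype
  obtain ⟨r, hr⟩ := exists_surjective_of_forall_not_injective (S := minimalPrimesBelow I)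
    fun f hf => not_injective_of_leeTerm_eq_top hα hI (fun i => (f i).2)
      (Subtype.val_injective.comp hf)
  exact ⟨Subtype.val ∘ r, by rw [hr.range_comp, Subtype.range_coe]⟩

/-- The homomorphism into the upsets of `P` dual to a map from `P` to the prime ideals. The ordering
of prime ideals is reversed by duality, and `hpc` is the dual form of preservation of `pc`. -/
def PHom.ofPrimeIdeals {α : Type u} [PAlgebra α] {P : Type v} [PartialOrder P]
    (J : P → Order.Ideal α) (hJ : ∀ X, (J X).IsPrime) (hanti : Antitone J)
    (hpc : ∀ X x, pc x ∈ J X → ∃ Y, X ≤ Y ∧ x ∉ J Y) : PHom α (Upset P) where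
  toFun x := ⟨{X | x ∉ J X}, fun _ _ h hx hx' => hx (hanti h hx')⟩
  map_inf x y := le_antisymm
    (fun X hX => ⟨fun h => hX ((J X).lower inf_le_left h),
      fun h => hX ((J X).lower inf_le_right h)⟩)
    fun X hX h => ((hJ X).mem_or_mem h).elim hX.1 hX.2
  map_sup x y := le_antisymm (fun _ hX => not_and_or.1 fun h => hX (Order.Ideal.sup_mem h.1 h.2))
    fun _ hX h => hX.elim (· (Order.Ideal.sup_mem_iff.1 h).1) (· (Order.Ideal.sup_mem_iff.1 h).2)
  map_pc x := by
    refine le_antisymm (fun X hX Y hXY hY => ?_) fun X hX h => ?_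
    · exact (mem_or_pc_mem (hJ Y) x).elim hY fun h => hX (hanti hXY h)
    · obtain ⟨Y, hXY, hY⟩ := hpc X x h
      exact hX Y hXY hY
  map_bot := le_bot_iff.1 fun X hX => hX (J X).bot_mem
  map_top := top_le_iff.1 fun X _ => (hJ X).toIsProper.top_notMem

/-- A colouring `g` of `M` is admissible for a family `F` if every member of `F` either is
monochromatic or meets every colour class of `g`. -/
def IsAdmissibleColoring {M : Type*} {κ : Type*} (F : Set (Set M)) (g : M → κ) : Prop :=
  ∀ X ∈ F, (g '' X).Subsingleton ∨ g '' X = Set.range g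

theorem IsAdmissibleColoring.comp {M κ κ' : Type*} {F : Set (Set M)} {g : M → κ}
    (hg : IsAdmissibleColoring F g) (r : κ → κ') : IsAdmissibleColoring F (r ∘ g) := by
  intro X hX
  rw [Set.image_comp, Set.range_comp]
  exact (hg X hX).imp (Set.Subsingleton.image · r) (congrArg (r '' ·))

namespace ReducedPoset

variable {M : Type u} {F : Set (Set M)}

variable (F) in
/-- The base `M`, the least element of `P(M, F)`. -/
def whole : ReducedPoset M F := ⟨Set.univ, .inl (.inl rfl)⟩

variable (F) in
/-- The singleton `{z}` as an element of `P(M, F)`. -/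
def point (z : M) : ReducedPoset M F := ⟨{z}, .inl (.inr ⟨z, rfl⟩)⟩

theorem nonempty [Nonempty M] (hF : ∀ X ∈ F, X.Nonempty) :
    ∀ X : ReducedPoset M F, X.1.Nonempty
  | ⟨_, .inl (.inl rfl)⟩ => Set.univ_nonempty
  | ⟨_, .inl (.inr ⟨z, rfl⟩)⟩ => Set.singleton_nonempty z
  | ⟨X, .inr hX⟩ => hF X hX

theorem le_point_iff {X : ReducedPoset M F} {z : M} : X ≤ point F z ↔ z ∈ X.1 :=
  Set.singleton_subset_iff

theorem isMax_point [Nonempty M] (hF : ∀ X ∈ F, X.Nonempty) (z : M) : IsMax (point F z) :=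
  fun X hX => ((Set.Nonempty.subset_singleton_iff (nonempty hF X)).1 hX).ge

end ReducedPoset

theorem image_subsingleton_or_eq_range_of_mem_baseSets {M : Type u} {κ : Type*} {X : Set M}
    (g : M → κ) (hX : X ∈ baseSets M) : (g '' X).Subsingleton ∨ g '' X = Set.range g := by
  rcases hX with rfl | ⟨z, rfl⟩
  exacts [.inr Set.image_univ, .inl (Set.subsingleton_singleton.image g)]

section ColorIdeal

open ReducedPoset

variable {α : Type u} [PAlgebra α] {M : Type v} {F : Set (Set M)} {I : Order.Ideal α}
  {g : M → Order.Ideal α} {X Y : ReducedPoset M F}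

open Classical in
/-- The map from `P(M, F)` to ideals given by a colouring `g` of the points: a monochromatic set
other than `M` goes to its colour, written `sInf (g '' X)`, and everything else goes to `I`. The set
`M` is excluded because it must go to `I` even when `g` is constant. -/
noncomputable def colorIdeal (I : Order.Ideal α) (g : M → Order.Ideal α) (X : ReducedPoset M F) :
    Order.Ideal α :=
  if X.1 ≠ Set.univ ∧ (g '' X.1).Subsingleton then sInf (g '' X.1) else I

theorem colorIdeal_whole : colorIdeal I g (whole F) = I :=
  if_neg fun h => h.1 rfl

theorem colorIdeal_eq_apply (hX : X.1 ≠ Set.univ) (hg : (g '' X.1).Subsingleton) {z : M}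
    (hz : z ∈ X.1) : colorIdeal I g X = g z := by
  rw [colorIdeal, if_pos ⟨hX, hg⟩, hg.eq_singleton_of_mem (Set.mem_image_of_mem g hz),
    sInf_singleton]

theorem colorIdeal_point [Nontrivial M] (z : M) : colorIdeal I g (point F z) = g z :=
  colorIdeal_eq_apply (Set.singleton_ne_univ z) (Set.subsingleton_singleton.image g)
    (Set.mem_singleton z)

theorem colorIdeal_cases (hg : IsAdmissibleColoring F g) (X : ReducedPoset M F) :
    (colorIdeal I g X = I ∧ g '' X.1 = Set.range g) ∨
      X.1 ≠ Set.univ ∧ (g '' X.1).Subsingleton := by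
  by_cases hX : X.1 ≠ Set.univ ∧ (g '' X.1).Subsingleton
  · exact .inr hX
  · refine .inl ⟨if_neg hX, ?_⟩
    rcases not_and_or.1 hX with hX | hX
    · rw [not_not.1 hX, Set.image_univ]
    · exact (X.2.elim (image_subsingleton_or_eq_range_of_mem_baseSets g) (hg X.1)).resolve_left hX

section

variable [Nonempty M] (hF : ∀ X ∈ F, X.Nonempty) (hg : IsAdmissibleColoring F g)
  (hrange : Set.range g = minimalPrimesBelow I)

include hF hg hrange

theorem colorIdeal_eq_or_mem (X : ReducedPoset M F) :
    (colorIdeal I g X = I ∧ g '' X.1 = minimalPrimesBelow I) ∨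
      colorIdeal I g X ∈ minimalPrimesBelow I := by
  refine (colorIdeal_cases hg X).imp (And.imp_right (·.trans hrange)) fun ⟨hX, hgX⟩ => ?_
  obtain ⟨z, hz⟩ := nonempty hF X
  exact colorIdeal_eq_apply hX hgX hz ▸ hrange ▸ Set.mem_range_self z

theorem isPrime_colorIdeal (hI : I.IsPrime) (X : ReducedPoset M F) :
    (colorIdeal I g X).IsPrime :=
  (colorIdeal_eq_or_mem hF hg hrange X).elim (fun h => h.1.symm ▸ hI) (·.1.prop)

theorem antitone_colorIdeal : Antitone (colorIdeal I g : ReducedPoset M F → Order.Ideal α) := by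
  intro X Y hXY
  rcases colorIdeal_cases (I := I) hg X with ⟨hX, -⟩ | ⟨hX, hgX⟩
  · rw [hX]
    exact (colorIdeal_eq_or_mem hF hg hrange Y).elim (fun h => h.1.le) (fun h => h.2)
  · obtain ⟨z, hz⟩ := nonempty hF Y
    have hY : Y.1 ≠ Set.univ := fun h => hX (Set.univ_subset_iff.1 (h ▸ hXY))
    rw [colorIdeal_eq_apply hX hgX (hXY hz),
      colorIdeal_eq_apply hY (hgX.anti (Set.image_mono hXY)) hz]

end

theorem exists_notMem_colorIdeal [Nontrivial M] (hF : ∀ X ∈ F, X.Nonempty)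
    (hg : IsAdmissibleColoring F g) (hrange : Set.range g = minimalPrimesBelow I)
    (hI : I.IsPrime) (X : ReducedPoset M F) (x : α) (hx : pc x ∈ colorIdeal I g X) :
    ∃ Y, X ≤ Y ∧ x ∉ colorIdeal I g Y := by
  rcases colorIdeal_eq_or_mem hF hg hrange X with ⟨hXI, hXg⟩ | hX
  · obtain ⟨K, hK, hKI, hxK⟩ := exists_minimal_isPrime_le hI (hXI ▸ hx)
    obtain ⟨z, hz, rfl⟩ : K ∈ g '' X.1 := hXg.ge ⟨hK, hKI⟩
    exact ⟨point F z, le_point_iff.2 hz, by rwa [colorIdeal_point]⟩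
  · exact ⟨X, le_rfl, (pc_mem_iff_of_minimal hX.1).1 hx⟩

end ColorIdeal

theorem mem_quasivarietyGen_dualAlg {m : ℕ} {B : PAlg.{w}}
    (hB : ∀ t : Fin (m + 1) → B.carrier, leeTerm t = ⊤) {M : Type u} [Nontrivial M]
    {F : Set (Set M)} (hF : ∀ X ∈ F, X.Nonempty) {g : M → Fin m} (hsurj : Surjective g)
    (hg : IsAdmissibleColoring F g) :
    B ∈ (quasivarietyGen (dualAlg (ReducedPoset M F)) : Set PAlg.{w}) := by
  refine mem_quasivarietyGen_of_separating fun x y hxy => ?_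
  by_contra hne
  wlog hle : ¬ x ≤ y generalizing x y
  · exact this y x (fun h => (hxy h).symm) (Ne.symm hne)
      fun hyx => hne (le_antisymm (not_not.1 hle) hyx)
  obtain ⟨I, hI, hx, hy⟩ := exists_isPrime_of_not_le hle
  obtain ⟨r, hr⟩ := exists_range_eq_minimalPrimesBelow hB hI
  have hrange : Set.range (r ∘ g) = minimalPrimesBelow I := (hsurj.range_comp r).trans hr
  have hadm : IsAdmissibleColoring F (r ∘ g) := hg.comp r
  have h := hxy <| PHom.ofPrimeIdeals (colorIdeal I (r ∘ g))
    (isPrime_colorIdeal hF hadm hrange hI) (antitone_colorIdeal hF hadm hrange)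
    (exists_notMem_colorIdeal hF hadm hrange hI)
  have hwhole : x ∉ colorIdeal I (r ∘ g) (ReducedPoset.whole F) ↔
      y ∉ colorIdeal I (r ∘ g) (ReducedPoset.whole F) :=
    Set.ext_iff.1 (congrArg Upset.carrier h) _
  rw [colorIdeal_whole] at hwhole
  exact hwhole.1 hx hy

theorem pc_barB_coe {m : ℕ} {s : Set (Fin m)} (hs : s.Nonempty) :
    pc (s : WithTop (Set (Fin m))) = (sᶜ : Set (Fin m)) :=
  if_neg hs.ne_empty

section Region

variable {m : ℕ} {P : Type u} [PartialOrder P] {X : P} {s t : Set (Fin m)} {i j : Fin m}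

/-- The upset of `P` that a homomorphism `B̄ₘ → ε(P)` assigns to an element of `B̄ₘ` other than the
new top, that is, to a set of atoms. -/
def region (h : PHom (WithTop (Set (Fin m))) (Upset P)) (s : Set (Fin m)) : Set P :=
  (h.toFun s).carrier

variable (h : PHom (WithTop (Set (Fin m))) (Upset P))

theorem isUpperSet_region (s : Set (Fin m)) : IsUpperSet (region h s) :=
  (h.toFun s).upper

theorem region_empty : region h ∅ = ∅ :=
  congrArg Upset.carrier h.map_bot

theorem region_union (s t : Set (Fin m)) : region h (s ∪ t) = region h s ∪ region h t :=
  congrArg Upset.carrier (h.map_sup s t)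

theorem region_inter (s t : Set (Fin m)) : region h (s ∩ t) = region h s ∩ region h t :=
  congrArg Upset.carrier (h.map_inf s t)

theorem region_mono : Monotone (region h) := by
  intro s t hst
  rw [← Set.inter_eq_left.2 hst, region_inter]
  exact Set.inter_subset_right

variable {h}

theorem mem_region_compl (hs : s.Nonempty) : X ∈ region h sᶜ ↔ ∀ Y, X ≤ Y → Y ∉ region h s := by
  have hpc := (congrArg h.toFun (pc_barB_coe hs)).symm.trans (h.map_pc s)
  exact Set.ext_iff.1 (congrArg Upset.carrier hpc) X

theorem exists_mem_region_singleton (hX : X ∈ region h s) : ∃ i, X ∈ region h {i} := by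
  induction s, s.toFinite using Set.Finite.induction_on with
  | empty => exact absurd hX (region_empty h ▸ Set.notMem_empty X)
  | @insert i s _ _ ih =>
    rw [Set.insert_eq, region_union] at hX
    exact hX.elim (fun hi => ⟨i, hi⟩) ih

theorem eq_of_mem_region_singleton (hi : X ∈ region h {i}) (hj : X ∈ region h {j}) : i = j := by
  by_contra hij
  have hX : X ∈ region h ({i} ∩ {j}) := (region_inter h {i} {j}).ge ⟨hi, hj⟩
  rw [Set.singleton_inter_eq_empty.2 (mt Set.mem_singleton_iff.1 hij), region_empty] at hX
  exact hX

theorem exists_mem_region_of_isMax [NeZero m] (hX : IsMax X) : ∃ i, X ∈ region h {i} := by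
  suffices X ∈ region h Set.univ from exists_mem_region_singleton this
  by_contra hcon
  have hcompl : X ∈ region h Set.univᶜ := (mem_region_compl Set.univ_nonempty).2 fun Y hXY hY =>
    hcon (isUpperSet_region h _ (hX hXY) hY)
  rw [Set.compl_univ, region_empty] at hcompl
  exact hcompl

theorem exists_le_mem_region_singleton (hX : X ∉ region h Set.univ) (i : Fin m) :
    ∃ Y, X ≤ Y ∧ Y ∈ region h {i} := by
  by_contra! hcon
  exact hX (region_mono h (Set.subset_univ _)
    ((mem_region_compl (Set.singleton_nonempty i)).2 hcon))

end Region

open ReducedPoset in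
theorem exists_isAdmissibleColoring_of_region_ne_univ {m : ℕ} [NeZero m] {M : Type u} [Nonempty M]
    {F : Set (Set M)} (hF : ∀ X ∈ F, X.Nonempty)
    {h : PHom (WithTop (Set (Fin m))) (Upset (ReducedPoset M F))}
    (hh : region h Set.univ ≠ Set.univ) :
    ∃ g : M → Fin m, Surjective g ∧ IsAdmissibleColoring F g := by
  choose g hg using fun z => exists_mem_region_of_isMax (h := h) (isMax_point hF z)
  have hcolor : ∀ {X : ReducedPoset M F} {i z}, X ∈ region h {i} → z ∈ X.1 → g z = i := fun hX hz =>
    eq_of_mem_region_singleton (hg _) (isUpperSet_region h _ (le_point_iff.2 hz) hX)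
  have hmeet : ∀ X ∉ region h Set.univ, ∀ i, ∃ z ∈ X.1, g z = i := by
    intro X hX i
    obtain ⟨Y, hXY, hY⟩ := exists_le_mem_region_singleton hX i
    obtain ⟨z, hz⟩ := nonempty hF Y
    exact ⟨z, hXY hz, hcolor hY hz⟩
  refine ⟨g, fun i => ?_, fun X hXF => ?_⟩
  · obtain ⟨X, hX⟩ := (Set.ne_univ_iff_exists_notMem _).1 hh
    obtain ⟨z, -, hz⟩ := hmeet X hX i
    exact ⟨z, hz⟩
  · let X' : ReducedPoset M F := ⟨X, .inr hXF⟩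
    by_cases hX : X' ∈ region h Set.univ
    · obtain ⟨i, hi⟩ := exists_mem_region_singleton hX
      refine .inl (Set.subsingleton_of_subset_singleton (a := i) ?_)
      exact Set.image_subset_iff.2 fun z hz => hcolor hi hz
    · refine .inr ((Set.image_subset_range g X).antisymm ?_)
      exact fun i _ => hmeet _ hX i

theorem theorem3p3_general (m : ℕ) [NeZero m] (M : Type u) [Nontrivial M] (F : Set (Set M))
    (hF : ∀ X ∈ F, X.Nonempty) :
    (Pa m : Set PAlg.{w}) ⊆ quasivarietyGen (dualAlg (ReducedPoset M F)) ↔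
      ∃ g : M → Fin m, Surjective g ∧ IsAdmissibleColoring F g := by
  constructor
  · intro hsub
    have : Finite (barB m).carrier := inferInstanceAs (Finite (Option (Set (Fin m))))
    have hne : (⟨((Set.univ : Set (Fin m)) : WithTop (Set (Fin m)))⟩ :
        ULift.{w} (barB m).carrier) ≠ ⊤ := fun h => WithTop.coe_ne_top (congrArg ULift.down h)
    obtain ⟨h, hh⟩ := separating_of_mem_quasivarietyGen (hsub (ulift_mem_HSP (barB m))) hne
    refine exists_isAdmissibleColoring_of_region_ne_univ hF (h := h.ofULift) fun huniv => hh ?_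
    rw [h.map_top]
    exact top_le_iff.1 fun X _ => huniv.ge (Set.mem_univ X)
  · rintro ⟨g, hsurj, hg⟩ B hB
    exact mem_quasivarietyGen_dualAlg
      (leeTerm_eq_top_of_mem_HSP (leeTerm_barB (by simp)) hB) hF hsurj hg

section Collision

variable {M : Type u} {κ : Type v} {g : M → κ} {a b : M} {X : Set M}

theorem card_subtype_ne_add_one [Finite M] (a : M) : Nat.card {x // x ≠ a} + 1 = Nat.card M := by
  classical
  rw [← Finite.card_option, Nat.card_congr (Equiv.optionSubtypeNe a)]

theorem exists_forall_sym2_eq_of_surjective [Finite M] (hcard : Nat.card M = Nat.card κ + 1)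
    (hg : Surjective g) :
    ∃ a b, a ≠ b ∧ ∀ ⦃z z'⦄, z ≠ z' → g z = g z' → s(z, z') = s(a, b) := by
  have hninj : ¬ Injective g := fun hinj => by
    have := Nat.card_eq_of_bijective g ⟨hinj, hg⟩
    omega
  obtain ⟨a, b, hgab, hab⟩ := not_injective_iff.1 hninj
  have hsurj : Surjective fun x : {x // x ≠ a} => g x := by
    intro i
    obtain ⟨z, rfl⟩ := hg i
    rcases eq_or_ne z a with rfl | hz
    · exact ⟨⟨b, hab.symm⟩, hgab.symm⟩
    · exact ⟨⟨z, hz⟩, rfl⟩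
  have hbij := hsurj.bijective_of_nat_card_le
    (Nat.add_right_cancel ((card_subtype_ne_add_one a).trans hcard)).le
  have hinj : ∀ {z z'}, z ≠ a → z' ≠ a → g z = g z' → z = z' := fun hz hz' h =>
    congrArg Subtype.val (@hbij.1 ⟨_, hz⟩ ⟨_, hz'⟩ h)
  refine ⟨a, b, hab, fun z z' hne h => ?_⟩
  rcases eq_or_ne z a with rfl | hz
  · rw [hinj hne.symm hab.symm (h.symm.trans hgab)]
  · rcases eq_or_ne z' a with rfl | hz'
    · rw [hinj hz hab.symm (h.trans hgab), Sym2.eq_swap]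
    · exact absurd (hinj hz hz' h) hne

theorem exists_surjective_apply_eq [Finite M] [Finite κ] (hcard : Nat.card M = Nat.card κ + 1)
    (hab : a ≠ b) : ∃ g : M → κ, Surjective g ∧ g a = g b := by
  classical
  obtain ⟨e⟩ : Nonempty ({x // x ≠ a} ≃ κ) := Finite.card_eq.1
    (Nat.add_right_cancel ((card_subtype_ne_add_one a).trans hcard))
  refine ⟨fun z => e (if hz : z = a then ⟨b, hab.symm⟩ else ⟨z, hz⟩), fun i => ?_, ?_⟩
  · exact ⟨e.symm i, (congrArg e (dif_neg (e.symm i).2)).trans (e.apply_symm_apply i)⟩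
  · simp only [dif_pos, dif_neg hab.symm]

theorem image_univ_diff_singleton (hab : a ≠ b) (hgab : g a = g b) :
    g '' (Set.univ \ {a}) = Set.range g := by
  refine (Set.image_subset_range g _).antisymm ?_
  rintro _ ⟨z, rfl⟩
  rcases eq_or_ne z a with rfl | hz
  · exact ⟨b, ⟨trivial, hab.symm⟩, hgab.symm⟩
  · exact ⟨z, ⟨trivial, hz⟩, rfl⟩

theorem eq_pair_of_image_subsingleton
    (hcol : ∀ ⦃z z'⦄, z ≠ z' → g z = g z' → s(z, z') = s(a, b)) (hX : X.Nontrivial)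
    (hgX : (g '' X).Subsingleton) : X = {a, b} := by
  have hpair : ∀ z ∈ X, ∀ z' ∈ X, z ≠ z' → s(z, z') = s(a, b) := fun z hz z' hz' hne =>
    hcol hne (hgX (Set.mem_image_of_mem g hz) (Set.mem_image_of_mem g hz'))
  ext x
  rw [Set.mem_insert_iff, Set.mem_singleton_iff, ← Sym2.mem_iff]
  constructor
  · intro hx
    obtain ⟨y, hy, hyx⟩ := hX.exists_ne x
    exact hpair x hx y hy hyx.symm ▸ Sym2.mem_mk_left x y
  · obtain ⟨z, hz, z', hz', hne⟩ := hX
    rw [← hpair z hz z' hz' hne, Sym2.mem_iff]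
    rintro (rfl | rfl) <;> assumption

theorem eq_univ_diff_singleton_of_image_eq_range
    (hcol : ∀ ⦃z z'⦄, z ≠ z' → g z = g z' → s(z, z') = s(a, b)) (hX : X ≠ Set.univ)
    (hgX : g '' X = Set.range g) : X = Set.univ \ {a} ∨ X = Set.univ \ {b} := by
  have hmiss : ∀ y ∉ X, ∃ z ∈ X, s(y, z) = s(a, b) := by
    intro y hy
    obtain ⟨z, hz, hgz⟩ := hgX.ge (Set.mem_range_self y)
    exact ⟨z, hz, hcol (fun h => hy (h ▸ hz)) hgz.symm⟩
  obtain ⟨y, hy⟩ := (Set.ne_univ_iff_exists_notMem X).1 hX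
  obtain ⟨z, hz, hyz⟩ := hmiss y hy
  have hXy : X = Set.univ \ {y} := by
    refine Set.Subset.antisymm (fun x hx => ⟨trivial, fun h => hy (h ▸ hx)⟩) fun x hx => ?_
    by_contra hxX
    obtain ⟨x', -, hxx'⟩ := hmiss x hxX
    rcases Sym2.mem_iff.1 (hyz.trans hxx'.symm ▸ Sym2.mem_mk_left x x') with rfl | rfl
    exacts [hx.2 rfl, hxX hz]
  rcases Sym2.mem_iff.1 (hyz ▸ Sym2.mem_mk_left y z) with rfl | rfl
  exacts [.inl hXy, .inr hXy]

theorem exists_isAdmissibleColoring_iff [Finite M] [Finite κ]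
    (hcard : Nat.card M = Nat.card κ + 1) {F : Set (Set M)} (hF : ∀ X ∈ F, X.Nonempty) :
    (∃ g : M → κ, Surjective g ∧ IsAdmissibleColoring F g) ↔
      ∃ a b : M, a ≠ b ∧
        F \ baseSets M ⊆ {({a, b} : Set M), Set.univ \ {a}, Set.univ \ {b}} := by
  constructor
  · rintro ⟨g, hsurj, hg⟩
    obtain ⟨a, b, hab, hcol⟩ := exists_forall_sym2_eq_of_surjective hcard hsurj
    refine ⟨a, b, hab, fun X ⟨hXF, hX⟩ => ?_⟩
    obtain ⟨huniv, hsingle⟩ := not_or.1 hX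
    refine (hg X hXF).imp (eq_pair_of_image_subsingleton hcol ?_)
      (eq_univ_diff_singleton_of_image_eq_range hcol huniv)
    exact (hF X hXF).exists_eq_singleton_or_nontrivial.resolve_left hsingle
  · rintro ⟨a, b, hab, hsub⟩
    obtain ⟨g, hsurj, hgab⟩ := exists_surjective_apply_eq hcard hab
    refine ⟨g, hsurj, fun X hXF => ?_⟩
    by_cases hX : X ∈ baseSets M
    · exact image_subsingleton_or_eq_range_of_mem_baseSets g hX
    · rcases hsub ⟨hXF, hX⟩ with rfl | rfl | rfl
      · refine .inl ?_
        rw [Set.image_pair, hgab, Set.pair_eq_singleton]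
        exact Set.subsingleton_singleton
      · exact .inr (image_univ_diff_singleton hab hgab)
      · exact .inr (image_univ_diff_singleton hab.symm hgab.symm)

end Collision

theorem theorem3p3 (m : ℕ) (hm : 2 ≤ m) (M : Type u) (hM : Nat.card M = m + 1)
    (F : Set (Set M)) (hF : ∀ X ∈ F, X.Nonempty) :
    (Pa m : Set PAlg.{w}) ⊆ quasivarietyGen (dualAlg (ReducedPoset M F)) ↔
      ∃ a b : M, a ≠ b ∧
        F \ baseSets M ⊆ {({a, b} : Set M), Set.univ \ {a}, Set.univ \ {b}} := by
  have : NeZero m := ⟨by omega⟩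
  have : Finite M := Nat.finite_of_card_ne_zero (by omega)
  have : Nontrivial M := Finite.one_lt_card_iff_nontrivial.1 (by omega)
  exact (theorem3p3_general m M F hF).trans
    (exists_isAdmissibleColoring_iff (by rw [hM, Nat.card_fin]) hF)
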